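/- **Setting.** All spaces are real. Let $\mathcal X,\mathcal F_{\mathcal Q}$ be Banach spaces with duals $\mathcal X',\mathcal F_{\mathcal Q}'$, put $\mathcal F=\mathcal X\times\mathcal F_{\mathcal Q}$, identify $\mathcal F'=\mathcal X'\times\mathcal F_{\mathcal Q}'$, and set $$\langle\!\langle(f_1,e_1),(f_2,e_2)\rangle\!\rangle=\langle f_1,e_2\rangle+\langle f_2,e_1\rangle,\qquad (f_i,e_i)\in\mathcal F\times\mathcal F'.$$ Let $\mathcal D\subset\mathcal F\times\mathcal F'$ be a Dirac structure, i.e. a linear subspace such that $(f,e)\in\mathcal D$ if and only if $\langle\!\langle(\hat f,\hat e),(f,e)\rangle\!\rangle=0$ for all $(\hat f,\hat e)\in\mathcal D$. Let $$\mathcal E=\Big\{\mathfrak e\in\mathcal X' : \exists\,\mathfrak f\in\mathcal X,\ \mathfrak f_{\mathcal Q}\in\mathcal F_{\mathcal Q},\ \mathfrak e_{\mathcal Q}\in\mathcal F_{\mathcal Q}'\ \text{ with } \big((\mathfrak f,\mathfrak f_{\mathcal Q}),(\mathfrak e,\mathfrak e_{\mathcal Q})\big)\in\mathcal D\Big\}$$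 be the space of occurring co-energy variables, with the norm $$\|\mathfrak e\|_{\mathcal E}=\inf\Big\{\big\|(\mathfrak f,\mathfrak f_{\mathcal Q},\mathfrak e,\mathfrak e_{\mathcal Q})\big\|_{\mathcal X\times\mathcal F_{\mathcal Q}\times\mathcal X'\times\mathcal F_{\mathcal Q}'} : \big((\mathfrak f,\mathfrak f_{\mathcal Q}),(\mathfrak e,\mathfrak e_{\mathcal Q})\big)\in\mathcal D\Big\}.$$ Let ${}^\perp\mathcal E=\{\mathfrak f\in\mathcal X:\langle\mathfrak f,\mathfrak e\rangle=0\ \forall\,\mathfrak e\in\mathcal E\}$ and let $\iota:\mathcal X\to\mathcal X/{}^\perp\mathcal E$, $\mathfrak f\mapsto\mathfrak f+{}^\perp\mathcal E$, where $\mathcal X/{}^\perp\mathcal E$ is regarded as a subspace of the dual $\mathcal E'$ of $(\mathcal E,\|\cdot\|_{\mathcal E})$ via $\langle\mathfrak e,\mathfrak f+{}^\perp\mathcal E\rangle_{\mathcal E,\mathcal E'}=\langle\mathfrak f,\mathfrak e\rangle_{\mathcal X,\mathcal X'}$. For an interval $I\subset\mathbb R$ and a Banach space $Z$, $C^1_0(I;Z)$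 denotes the continuously differentiable functions whose support is a compact subset of the interior of $I$; $L^p_{\rm loc}(I;Z)$ the functions that are (Bochner) $p$-integrable on every compact subset of $I$; and $W^{1,p}_{\rm loc}(I;Z)$ the functions $u\in L^p_{\rm loc}(I;Z)$ having a weak derivative $g\in L^p_{\rm loc}(I;Z)$, i.e. $\int_I\varphi'u\,dt=-\int_I\varphi g\,dt$ for all real-valued $\varphi\in C^\infty_0(I)$. **Theorem.** Assume that $(\mathcal E,\|\cdot\|_{\mathcal E})$ is reflexive. Let $I\subset\mathbb R$ be an interval, $p\in[1,\infty)$, and let $x\in C(I;\mathcal X)$, $e\in L^p_{\rm loc}(I;\mathcal X')$, $f_{\mathcal Q}\in L^p_{\rm loc}(I;\mathcal F_{\mathcal Q})$, $e_{\mathcal Q}\in L^p_{\rm loc}(I;\mathcal F_{\mathcal Q}')$ be such that for all $\chi\in C^1_0(I;\mathcal X)$, $\varrho\in C^1_0(I;\mathcal X')$, $\chi_{\mathcal Q}\in C^1_0(I;\mathcal F_{\mathcal Q})$, $\varrho_{\mathcal Q}\in C^1_0(I;\mathcal F_{\mathcal Q}')$ with $\big((\chi(t),\chi_{\mathcal Q}(t)),(\varrho(t),\varrho_{\mathcal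 Q}(t))\big)\in\mathcal D$ for all $t\in I$, $$\int_I\Big\langle\!\Big\langle\big((x(t),f_{\mathcal Q}(t)),(e(t),e_{\mathcal Q}(t))\big),\big((\chi(t),\chi_{\mathcal Q}(t)),(\tfrac{d}{dt}\varrho(t),\varrho_{\mathcal Q}(t))\big)\Big\rangle\!\Big\rangle\,dt=0.$$ Then $\iota x\in W^{1,p}_{\rm loc}(I;\mathcal E')$. -/

import Mathlib

open MeasureTheory Set
open scoped ENNReal ContDiff

noncomputable section

namespace PortHamiltonian

/-! ### Dirac structures -/

section Dirac

variable {F : Type*} [NormedAddCommGroup F] [NormedSpace ℝ F]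

/-- The indefinite inner product on the bond space `F × F'`:
`⟪⟪(f₁, e₁), (f₂, e₂)⟫⟫ = ⟨f₁, e₂⟩ + ⟨f₂, e₁⟩`. -/
def bondForm (a b : F × StrongDual ℝ F) : ℝ :=
  b.2 a.1 + a.2 b.1

/-- A subspace `D` of `F × F'` is a Dirac structure if it coincides with its orthogonal complement
with respect to the indefinite inner product. -/
def IsDiracStructure (D : Submodule ℝ (F × StrongDual ℝ F)) : Prop :=
  ∀ (f : F) (e : StrongDual ℝ F), (f, e) ∈ D ↔ ∀ a ∈ D, bondForm a (f, e) = 0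

end Dirac

/-! ### Function spaces on an interval -/

section FunctionSpaces

variable {Z : Type*} [NormedAddCommGroup Z]

/-- `u ∈ L^p_loc(I; Z)`: `u` is `p`-integrable over every compact subset of `I`. Functions on `I`
are represented by functions on `ℝ`, whose values outside `I` are irrelevant. -/
def MemLpLoc (u : ℝ → Z) (p : ℝ≥0∞) (I : Set ℝ) : Prop :=
  ∀ K ⊆ I, IsCompact K → MemLp u p (volume.restrict K)

variable [NormedSpace ℝ Z]

/-- `u ∈ C¹₀(I; Z)`: `u` is continuously differentiable with compact support inside the interior
of `I`. Such a function is represented by its extension by zero to `ℝ`. -/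
def IsTestC1 (I : Set ℝ) (u : ℝ → Z) : Prop :=
  ContDiff ℝ 1 u ∧ HasCompactSupport u ∧ tsupport u ⊆ interior I

/-- `g` is a weak derivative of `u` on `I`: `∫ φ' u = - ∫ φ g` (Bochner integrals) for all
real-valued smooth `φ` with compact support in the interior of `I`. -/
def IsWeakDerivOn (I : Set ℝ) (u g : ℝ → Z) : Prop :=
  ∀ φ : ℝ → ℝ, ContDiff ℝ ∞ φ → HasCompactSupport φ → tsupport φ ⊆ interior I →
    ∫ t in I, deriv φ t • u t = -∫ t in I, φ t • g t

/-- `u ∈ W^{1,p}_loc(I; Z)`. -/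
def MemW1pLoc (u : ℝ → Z) (p : ℝ≥0∞) (I : Set ℝ) : Prop :=
  MemLpLoc u p I ∧ ∃ g : ℝ → Z, MemLpLoc g p I ∧ IsWeakDerivOn I u g

/-- A normed space is reflexive if its canonical embedding into the bidual is onto. -/
def IsReflexive (Z : Type*) [NormedAddCommGroup Z] [NormedSpace ℝ Z] : Prop :=
  Function.Surjective (NormedSpace.inclusionInDoubleDual ℝ Z)

end FunctionSpaces

/-! ### The space of occurring co-energy variables

The dual of `X × Q` is identified with `X' × Q'` as usual: the pair `(e, e_Q)` is the functional
`e.coprod eQ : (f, f_Q) ↦ ⟨f, e⟩ + ⟨f_Q, e_Q⟩`. -/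

section Coenergy

variable {X Q : Type*} [NormedAddCommGroup X] [NormedSpace ℝ X]
  [NormedAddCommGroup Q] [NormedSpace ℝ Q]

/-- The space of occurring co-energy variables as a subspace of `X'`. -/
def coenergySubmodule (D : Submodule ℝ ((X × Q) × StrongDual ℝ (X × Q))) :
    Submodule ℝ (StrongDual ℝ X) where
  carrier := {e | ∃ (f : X) (fQ : Q) (eQ : StrongDual ℝ Q), ((f, fQ), e.coprod eQ) ∈ D}
  zero_mem' := ⟨0, 0, 0, by
    convert D.zero_mem using 1
    ext <;> simp⟩
  add_mem' := by
    rintro a b ⟨f, fQ, eQ, h⟩ ⟨f', fQ', eQ', h'⟩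
    refine ⟨f + f', fQ + fQ', eQ + eQ', ?_⟩
    convert D.add_mem h h' using 1
    ext <;> simp
  smul_mem' := by
    rintro c a ⟨f, fQ, eQ, h⟩
    refine ⟨c • f, c • fQ, c • eQ, ?_⟩
    convert D.smul_mem c h using 1
    ext <;> simp

/-- The space `ℰ` of occurring co-energy variables, as a type of its own: it does not carry the
norm of `X'`, but the norm below. -/
def CoenergySpace (D : Submodule ℝ ((X × Q) × StrongDual ℝ (X × Q))) : Type _ :=
  coenergySubmodule D

variable (D : Submodule ℝ ((X × Q) × StrongDual ℝ (X × Q)))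

instance : AddCommGroup (CoenergySpace D) :=
  inferInstanceAs (AddCommGroup (coenergySubmodule D))

instance : Module ℝ (CoenergySpace D) :=
  inferInstanceAs (Module ℝ (coenergySubmodule D))

/-- The inclusion of `ℰ` into `X'`. -/
def CoenergySpace.toDual : CoenergySpace D →ₗ[ℝ] StrongDual ℝ X :=
  (coenergySubmodule D).subtype

/-- The norms of all elements `((f, f_Q), (e, e_Q))` of `D` with the given component `e`. -/
def liftNorms (e : StrongDual ℝ X) : Set ℝ :=
  {r | ∃ (f : X) (fQ : Q) (eQ : StrongDual ℝ Q),
    ((f, fQ), e.coprod eQ) ∈ D ∧ r = ‖((f, fQ), (e, eQ))‖}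

/-- The norm of `ℰ`. -/
instance : Norm (CoenergySpace D) :=
  ⟨fun e => sInf (liftNorms D (CoenergySpace.toDual D e))⟩

theorem CoenergySpace.norm_def (e : CoenergySpace D) :
    ‖e‖ = sInf (liftNorms D (CoenergySpace.toDual D e)) := rfl

theorem CoenergySpace.toDual_injective : Function.Injective (CoenergySpace.toDual D) :=
  Subtype.val_injective

theorem liftNorms_bddBelow (e : StrongDual ℝ X) : BddBelow (liftNorms D e) :=
  ⟨0, by rintro r ⟨f, fQ, eQ, -, rfl⟩; exact norm_nonneg _⟩

theorem liftNorms_nonempty (e : CoenergySpace D) :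
    (liftNorms D (CoenergySpace.toDual D e)).Nonempty := by
  obtain ⟨f, fQ, eQ, h⟩ := e.2
  exact ⟨_, f, fQ, eQ, h, rfl⟩

theorem CoenergySpace.norm_toDual_le (e : CoenergySpace D) :
    ‖CoenergySpace.toDual D e‖ ≤ ‖e‖ := by
  refine le_csInf (liftNorms_nonempty D e) ?_
  rintro r ⟨f, fQ, eQ, -, rfl⟩
  exact (norm_fst_le (CoenergySpace.toDual D e, eQ)).trans
    (norm_snd_le ((f, fQ), (CoenergySpace.toDual D e, eQ)))

theorem CoenergySpace.norm_smul_le (c : ℝ) (e : CoenergySpace D) : ‖c • e‖ ≤ ‖c‖ * ‖e‖ := by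
  rw [CoenergySpace.norm_def D e, ← smul_eq_mul ‖c‖,
    ← Real.sInf_smul_of_nonneg (norm_nonneg c)]
  refine le_csInf ((liftNorms_nonempty D e).smul_set) ?_
  rintro _ ⟨_, ⟨f, fQ, eQ, h, rfl⟩, rfl⟩
  refine csInf_le (liftNorms_bddBelow D _) ⟨c • f, c • fQ, c • eQ, ?_, ?_⟩
  · convert D.smul_mem c h using 1
    ext <;> simp
  · rw [map_smul]
    exact (norm_smul c ((f, fQ), (CoenergySpace.toDual D e, eQ))).symm.trans
      (congrArg norm rfl)

theorem CoenergySpace.core : NormedSpace.Core ℝ (CoenergySpace D) where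
  norm_nonneg e := (norm_nonneg _).trans (CoenergySpace.norm_toDual_le D e)
  norm_smul c e := by
    refine le_antisymm (CoenergySpace.norm_smul_le D c e) ?_
    rcases eq_or_ne c 0 with rfl | hc
    · rw [norm_zero, zero_mul]
      exact (norm_nonneg _).trans (CoenergySpace.norm_toDual_le D _)
    · have h := CoenergySpace.norm_smul_le D c⁻¹ (c • e)
      rw [smul_smul, inv_mul_cancel₀ hc, one_smul, norm_inv] at h
      have hc' : 0 < ‖c‖ := norm_pos_iff.2 hc
      calc ‖c‖ * ‖e‖ ≤ ‖c‖ * (‖c‖⁻¹ * ‖c • e‖) := by gcongr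
        _ = ‖c • e‖ := by rw [← mul_assoc, mul_inv_cancel₀ hc'.ne', one_mul]
  norm_triangle a b := by
    refine le_of_forall_pos_le_add fun ε hε => ?_
    obtain ⟨_, ⟨f, fQ, eQ, h, rfl⟩, hr⟩ :=
      exists_lt_of_csInf_lt (liftNorms_nonempty D a)
        (lt_add_of_pos_right (sInf (liftNorms D (CoenergySpace.toDual D a))) (half_pos hε))
    obtain ⟨_, ⟨f', fQ', eQ', h', rfl⟩, hr'⟩ :=
      exists_lt_of_csInf_lt (liftNorms_nonempty D b)
        (lt_add_of_pos_right (sInf (liftNorms D (CoenergySpace.toDual D b))) (half_pos hε))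
    have key : ‖a + b‖ ≤ ‖((f, fQ), (CoenergySpace.toDual D a, eQ)) +
        ((f', fQ'), (CoenergySpace.toDual D b, eQ'))‖ := by
      refine csInf_le (liftNorms_bddBelow D _) ⟨f + f', fQ + fQ', eQ + eQ', ?_, ?_⟩
      · convert D.add_mem h h' using 1
        ext <;> simp
      · rw [map_add]
        rfl
    have := key.trans (norm_add_le _ _)
    rw [CoenergySpace.norm_def D a, CoenergySpace.norm_def D b]
    linarith
  norm_eq_zero_iff e := by
    constructor
    · intro h
      have h1 := CoenergySpace.norm_toDual_le D e
      rw [h] at h1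
      apply CoenergySpace.toDual_injective D
      rw [map_zero]
      exact norm_le_zero_iff.1 h1
    · rintro rfl
      have h := CoenergySpace.norm_smul_le D 0 0
      rw [norm_zero, zero_mul, smul_zero] at h
      exact le_antisymm h ((norm_nonneg _).trans (CoenergySpace.norm_toDual_le D _))

instance : NormedAddCommGroup (CoenergySpace D) :=
  NormedAddCommGroup.ofCore (CoenergySpace.core D)

instance : NormedSpace ℝ (CoenergySpace D) :=
  NormedSpace.ofCore (CoenergySpace.core D)

/-! ### The canonical map into the state extrapolation space -/

/-- The annihilator `^⊥ℰ = {f ∈ X | ⟨f, e⟩ = 0 for all e ∈ ℰ}`. -/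
def coenergyAnnihilator : Submodule ℝ X where
  carrier := {f | ∀ e ∈ coenergySubmodule D, e f = 0}
  zero_mem' := fun e _ => map_zero e
  add_mem' := fun ha hb e he => by rw [map_add, ha e he, hb e he, add_zero]
  smul_mem' := fun c f hf e he => by rw [map_smul, hf e he, smul_zero]

/-- The functional `e ↦ ⟨f, e⟩` on `ℰ`, for `f ∈ X`. -/
def evalCoenergy : X →ₗ[ℝ] StrongDual ℝ (CoenergySpace D) where
  toFun f := LinearMap.mkContinuous
    { toFun := fun e => CoenergySpace.toDual D e f
      map_add' := fun a b => by rw [map_add]; rfl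
      map_smul' := fun c a => by rw [map_smul]; rfl } ‖f‖ fun e => by
        refine ((CoenergySpace.toDual D e).le_opNorm f).trans ?_
        rw [mul_comm]
        exact mul_le_mul_of_nonneg_left (CoenergySpace.norm_toDual_le D e) (norm_nonneg f)
  map_add' f g := by
    ext e
    exact map_add (CoenergySpace.toDual D e) f g
  map_smul' c f := by
    ext e
    exact map_smul (CoenergySpace.toDual D e) c f

theorem evalCoenergy_apply (f : X) (e : CoenergySpace D) :
    evalCoenergy D f e = CoenergySpace.toDual D e f := rfl

theorem ker_evalCoenergy : LinearMap.ker (evalCoenergy D) = coenergyAnnihilator D := by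
  ext f
  constructor
  · intro hf e he
    exact DFunLike.congr_fun (LinearMap.mem_ker.1 hf) (⟨e, he⟩ : CoenergySpace D)
  · intro hf
    refine LinearMap.mem_ker.2 ?_
    ext e
    exact hf _ e.2

/-- The embedding of `X / ^⊥ℰ` into the state extrapolation space `ℰ'`, given by
`⟨e, f + ^⊥ℰ⟩ = ⟨f, e⟩`. -/
def quotientEmbedding : (X ⧸ coenergyAnnihilator D) →ₗ[ℝ] StrongDual ℝ (CoenergySpace D) :=
  (coenergyAnnihilator D).liftQ (evalCoenergy D) (ker_evalCoenergy D).ge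

theorem quotientEmbedding_injective : Function.Injective (quotientEmbedding D) :=
  LinearMap.ker_eq_bot.1
    (Submodule.ker_liftQ_eq_bot _ _ _ (ker_evalCoenergy D).le)

/-- The canonical map `ι`, `f ↦ f + ^⊥ℰ`, with `X / ^⊥ℰ` regarded as a subspace of `ℰ'`. -/
def iota : X →ₗ[ℝ] StrongDual ℝ (CoenergySpace D) :=
  quotientEmbedding D ∘ₗ (coenergyAnnihilator D).mkQ

theorem iota_apply (f : X) (e : CoenergySpace D) :
    iota D f e = CoenergySpace.toDual D e f := rfl

end Coenergy

end PortHamiltonian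

end

/-!
Fix a co-energy variable `ε` and a lift `((f, f_Q), (ε, e_Q'))` of it to `D`. Multiplying the lift
by a scalar test function `φ` gives admissible test functions, and the weak formulation then says
that `⟨ε, x(t)⟩` has the weak derivative `G_ε(t) = ⟨f, e(t)⟩ + ⟨f_Q', e_Q(t)⟩ + ⟨f_Q(t), e_Q'⟩`,
where `f_Q'` is the `Q`-component of the lift. If the lift has norm at most `2 ‖ε‖`
(`CoenergySpace.exists_lift`), then `|G_ε| ≤ m ‖ε‖` with
`m = 2 (‖e‖ + ‖e_Q‖ + ‖f_Q‖) ∈ L^p_loc`.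

It remains to assemble the scalar derivatives `G_ε` into one strongly measurable `ℰ'`-valued
function, and this is where reflexivity enters, as a form of the Radon-Nikodym property of
reflexive spaces (`memW1pLoc_of_forall_dual`). As `u = ι x` is continuous, it takes its values in a
separable closed subspace `P` of `ℰ'`, which is again reflexive
(`IsReflexive.submodule_of_isClosed`). Take a sequence `ψ i` of functionals separating the points
of `P`. Weak derivatives being unique, for almost every `t` the inequality
`|∑ a_i G_{ψ i}(t)| ≤ m(t) ‖∑ a_i ψ i‖` holds for all rational coefficients at once; by Helly's
moment criterion (`exists_strongDual_apply_eq`) and reflexivity of `P` there is `g(t) ∈ P` of norm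
at most `m(t)` with `ψ i (g(t)) = G_{ψ i}(t)` for all `i`. Since the `ψ i` embed `P` measurably into
`ℝ^ℕ`, the function `g` is strongly measurable, and it is the weak derivative of `u` because it is
so after applying each `ψ i`.
-/

namespace PortHamiltonian

/-! ### Reflexive spaces -/

section Reflexive

variable {Z : Type*} [NormedAddCommGroup Z] [NormedSpace ℝ Z]

theorem IsReflexive.strongDual (h : IsReflexive Z) : IsReflexive (StrongDual ℝ Z) := by
  intro Φ
  refine ⟨Φ.comp (NormedSpace.inclusionInDoubleDual ℝ Z), ?_⟩
  ext ψ
  obtain ⟨z, rfl⟩ := h ψ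
  rfl

theorem IsReflexive.submodule_of_isClosed (h : IsReflexive Z) (P : Submodule ℝ Z)
    (hP : IsClosed (P : Set Z)) : IsReflexive P := by
  intro Φ
  -- `Φ`, composed with the restriction `Z' → P'`, is evaluation at some `z`.
  obtain ⟨z, hz⟩ := h (Φ.comp ((ContinuousLinearMap.compL ℝ P Z ℝ).flip P.subtypeL))
  have hz' : ∀ ψ : StrongDual ℝ Z, ψ z = Φ (ψ.comp P.subtypeL) := fun ψ =>
    DFunLike.congr_fun hz ψ
  have hzP : z ∈ P := by
    by_contra hzP
    obtain ⟨ψ, c, hψ, hc⟩ := geometric_hahn_banach_closed_point P.convex hP hzP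
    -- A functional bounded above on a subspace vanishes there.
    have hψ0 : ∀ y ∈ P, ψ y = 0 := by
      intro y hy
      by_contra hne
      have h1 := hψ ((c / ψ y) • y) (P.smul_mem _ hy)
      rw [map_smul, smul_eq_mul, div_mul_cancel₀ _ hne] at h1
      exact lt_irrefl _ h1
    have h0 : ψ.comp P.subtypeL = 0 := by
      ext y
      exact hψ0 y y.2
    have h1 := hz' ψ
    rw [h0, map_zero] at h1
    have h2 := hψ 0 P.zero_mem
    rw [map_zero] at h2
    linarith
  refine ⟨⟨z, hzP⟩, ?_⟩
  ext ψ
  obtain ⟨ψ', hψ', -⟩ := exists_extension_norm_eq P ψ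
  have h1 : ψ'.comp P.subtypeL = ψ := by
    ext y
    exact hψ' y
  rw [NormedSpace.dual_def, ← h1, ← hz' ψ']
  rfl

/-- Helly's moment criterion: a functional of norm at most `M` with prescribed values `c i` at
`z i` exists as soon as the obvious norm inequality holds for all rational combinations of the
`z i`. -/
theorem exists_strongDual_apply_eq (z : ℕ → Z) (c : ℕ → ℝ) {M : ℝ} (hM : 0 ≤ M)
    (h : ∀ (n : ℕ) (a : Fin n → ℚ),
      |∑ i, (a i : ℝ) * c i| ≤ M * ‖∑ i, (a i : ℝ) • z i‖) :
    ∃ ψ : StrongDual ℝ Z, ‖ψ‖ ≤ M ∧ ∀ i, ψ (z i) = c i := by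
  have hreal : ∀ (n : ℕ) (a : Fin n → ℝ),
      |∑ i, a i * c i| ≤ M * ‖∑ i, a i • z i‖ := by
    intro n a
    have hd : DenseRange (fun (a : Fin n → ℚ) (i : Fin n) => (a i : ℝ)) :=
      DenseRange.piMap fun _ => Rat.denseRange_cast
    refine hd.induction_on (p := fun a : Fin n → ℝ =>
      |∑ i, a i * c i| ≤ M * ‖∑ i, a i • z i‖) a ?_ (h n)
    exact isClosed_le (by fun_prop) (by fun_prop)
  set S := Finsupp.linearCombination ℝ z
  set T := Finsupp.linearCombination ℝ c
  have hST : ∀ l : ℕ →₀ ℝ, |T l| ≤ M * ‖S l‖ := by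
    intro l
    obtain ⟨n, hn⟩ := l.support.exists_nat_subset_range
    have hS : S l = ∑ i : Fin n, l i • z i :=
      (Finsupp.sum_of_support_subset l hn _ (by simp)).trans
        (Finset.sum_range fun i => l i • z i)
    have hT : T l = ∑ i : Fin n, l i * c i :=
      (Finsupp.sum_of_support_subset l hn _ (by simp)).trans
        (Finset.sum_range fun i => l i • c i)
    rw [hS, hT]
    exact hreal n _
  have hker : LinearMap.ker S ≤ LinearMap.ker T := by
    intro l hl
    have h1 := hST l
    rw [LinearMap.mem_ker.1 hl, norm_zero, mul_zero] at h1
    exact abs_nonpos_iff.1 h1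
  let L : LinearMap.range S →ₗ[ℝ] ℝ :=
    (LinearMap.ker S).liftQ T hker ∘ₗ S.quotKerEquivRange.symm.toLinearMap
  have hL : ∀ l, L ⟨S l, l, rfl⟩ = T l := by
    intro l
    have h1 : S.quotKerEquivRange.symm ⟨S l, l, rfl⟩ = (LinearMap.ker S).mkQ l := by
      rw [LinearEquiv.symm_apply_eq]
      rfl
    change (LinearMap.ker S).liftQ T hker (S.quotKerEquivRange.symm ⟨S l, l, rfl⟩) = T l
    rw [h1]
    exact Submodule.liftQ_apply _ _ _
  have hb : ∀ y, ‖L y‖ ≤ M * ‖y‖ := by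
    rintro ⟨_, l, rfl⟩
    rw [hL]
    exact hST l
  obtain ⟨ψ, hψ, hn⟩ := exists_extension_norm_eq _ (L.mkContinuous M hb)
  refine ⟨ψ, hn.le.trans (LinearMap.mkContinuous_norm_le _ hM _), fun i => ?_⟩
  have hS : S (Finsupp.single i 1) = z i := by simp [S]
  have hT : T (Finsupp.single i 1) = c i := by simp [T]
  have h1 := hψ ⟨S (Finsupp.single i 1), _, rfl⟩
  rw [LinearMap.mkContinuous_apply, hL, hT] at h1
  rw [← hS]
  exact h1

/-- Norming functionals of a dense sequence separate points. -/
theorem exists_separating_sequence [SecondCountableTopology Z] :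
    ∃ ψ : ℕ → StrongDual ℝ Z, ∀ y z : Z, (∀ i, ψ i y = ψ i z) → y = z := by
  choose ψ hψ hψ' using fun i => exists_dual_vector'' ℝ (TopologicalSpace.denseSeq Z i)
  refine ⟨ψ, fun y z h => ?_⟩
  by_contra hne
  have hpos : 0 < ‖y - z‖ := norm_pos_iff.2 (sub_ne_zero.2 hne)
  obtain ⟨i, hi⟩ := Metric.denseRange_iff.1 (TopologicalSpace.denseRange_denseSeq Z) (y - z)
    (‖y - z‖ / 2) (half_pos hpos)
  set w := TopologicalSpace.denseSeq Z i
  rw [dist_eq_norm] at hi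
  have h0 : ψ i (y - z) = 0 := by rw [map_sub, h i, sub_self]
  have h1 : ‖w‖ ≤ ‖y - z - w‖ := by
    have h2 := (ψ i).le_of_opNorm_le (hψ i) (y - z - w)
    have h3 : ψ i w = ‖w‖ := hψ' i
    rw [map_sub, h0, h3, zero_sub, norm_neg, one_mul, norm_norm] at h2
    exact h2
  have h2 := norm_le_norm_add_norm_sub' (y - z) w
  linarith

end Reflexive

/-! ### Locally integrable functions and weak derivatives -/

section WeakDerivative

variable {Z : Type*} [NormedAddCommGroup Z] {I : Set ℝ} {p : ℝ≥0∞}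

theorem volume_restrict_interior (hI : I.OrdConnected) :
    (volume.restrict (interior I) : Measure ℝ) = volume.restrict I :=
  Measure.restrict_congr_set (interior_ae_eq_of_null_frontier
    (hI.convex.addHaar_frontier volume))

theorem MemLpLoc.locallyIntegrableOn_interior {u : ℝ → Z} (hu : MemLpLoc u p I) (hp : 1 ≤ p) :
    LocallyIntegrableOn u (interior I) volume := by
  refine (locallyIntegrableOn_iff isOpen_interior.isLocallyClosed).2 fun K hK hKc => ?_
  have : IsFiniteMeasure (volume.restrict K : Measure ℝ) :=
    isFiniteMeasure_restrict.2 hKc.measure_lt_top.ne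
  exact (hu K (hK.trans interior_subset) hKc).integrable hp

theorem MemLpLoc.aestronglyMeasurable {u : ℝ → Z} (hu : MemLpLoc u p I) (hp : 1 ≤ p)
    (hI : I.OrdConnected) : AEStronglyMeasurable u (volume.restrict I) := by
  rw [← volume_restrict_interior hI]
  exact (hu.locallyIntegrableOn_interior hp).aestronglyMeasurable

theorem MemLpLoc.of_le {Z' : Type*} [NormedAddCommGroup Z'] {u : ℝ → Z} {m : ℝ → Z'}
    (hm : MemLpLoc m p I) (hu : AEStronglyMeasurable u (volume.restrict I))
    (h : ∀ᵐ t ∂(volume.restrict I), ‖u t‖ ≤ ‖m t‖) : MemLpLoc u p I := fun K hK hKc =>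
  (hm K hK hKc).of_le (hu.mono_set hK) (ae_restrict_of_ae_restrict_of_subset hK h)

theorem MemLpLoc.add {u v : ℝ → Z} (hu : MemLpLoc u p I) (hv : MemLpLoc v p I) :
    MemLpLoc (fun t => u t + v t) p I := fun K hK hKc => (hu K hK hKc).add (hv K hK hKc)

theorem MemLpLoc.norm {u : ℝ → Z} (hu : MemLpLoc u p I) :
    MemLpLoc (fun t => ‖u t‖) p I := fun K hK hKc => (hu K hK hKc).norm

theorem _root_.ContinuousOn.memLpLoc {u : ℝ → Z} (hu : ContinuousOn u I) (p : ℝ≥0∞) :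
    MemLpLoc u p I := by
  intro K hK hKc
  have : IsFiniteMeasure (volume.restrict K : Measure ℝ) :=
    isFiniteMeasure_restrict.2 hKc.measure_lt_top.ne
  obtain ⟨C, hC⟩ := hKc.exists_bound_of_continuousOn (hu.mono hK)
  exact MemLp.of_bound ((hu.mono hK).aestronglyMeasurable_of_isCompact hKc hKc.measurableSet) C
    ((ae_restrict_iff' hKc.measurableSet).2 (Filter.Eventually.of_forall hC))

variable [NormedSpace ℝ Z]

theorem MemLpLoc.clm_comp {Z' : Type*} [NormedAddCommGroup Z'] [NormedSpace ℝ Z'] {u : ℝ → Z}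
    (hu : MemLpLoc u p I) (L : Z →L[ℝ] Z') : MemLpLoc (fun t => L (u t)) p I :=
  fun K hK hKc => L.comp_memLp' (hu K hK hKc)

theorem MemLpLoc.const_mul {u : ℝ → ℝ} (hu : MemLpLoc u p I) (c : ℝ) :
    MemLpLoc (fun t => c * u t) p I := fun K hK hKc => (hu K hK hKc).const_mul c

theorem MemLpLoc.integrableOn_smul {u : ℝ → Z} (hu : MemLpLoc u p I) (hp : 1 ≤ p) {φ : ℝ → ℝ}
    (hφ : Continuous φ) (hφc : HasCompactSupport φ) (hφI : tsupport φ ⊆ interior I) :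
    IntegrableOn (fun t => φ t • u t) I := by
  have h1 : IntegrableOn (fun t => φ t • u t) (tsupport φ) :=
    IntegrableOn.continuousOn_smul ((hu.locallyIntegrableOn_interior hp).integrableOn_compact_subset
      hφI hφc) hφ.continuousOn hφc
  rw [integrableOn_iff_integrable_of_support_subset] at h1
  · exact h1.integrableOn
  · exact (Function.support_smul_subset_left _ _).trans (subset_tsupport φ)

theorem tsupport_deriv_subset_of_subset {φ : ℝ → ℝ} {s : Set ℝ} (h : tsupport φ ⊆ s) :
    tsupport (deriv φ) ⊆ s :=
  (closure_minimal support_deriv_subset (isClosed_tsupport φ)).trans h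

theorem MemLpLoc.integrableOn_deriv_smul {u : ℝ → Z} (hu : MemLpLoc u p I) (hp : 1 ≤ p)
    {φ : ℝ → ℝ} (hφ : ContDiff ℝ ∞ φ) (hφc : HasCompactSupport φ)
    (hφI : tsupport φ ⊆ interior I) : IntegrableOn (fun t => deriv φ t • u t) I :=
  hu.integrableOn_smul hp (hφ.continuous_deriv (by simp)) hφc.deriv
    (tsupport_deriv_subset_of_subset hφI)

/-- Weak derivatives are unique (for scalar functions), here for two functions that agree on
`I`. -/
theorem IsWeakDerivOn.ae_eq (hI : I.OrdConnected) (hp : 1 ≤ p) {v w G H : ℝ → ℝ}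
    (hvG : IsWeakDerivOn I v G) (hwH : IsWeakDerivOn I w H) (hG : MemLpLoc G p I)
    (hH : MemLpLoc H p I) (hvw : ∀ t ∈ I, v t = w t) :
    G =ᵐ[volume.restrict I] H := by
  have h := isOpen_interior.ae_eq_zero_of_integral_contDiff_smul_eq_zero
    ((hG.locallyIntegrableOn_interior hp).sub (hH.locallyIntegrableOn_interior hp)) (by
      intro φ hφ hφc hφI
      have h1 : ∫ t in I, deriv φ t • v t = ∫ t in I, deriv φ t • w t :=
        setIntegral_congr_fun hI.measurableSet fun t ht => by simp only [hvw t ht]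
      rw [hvG φ hφ hφc hφI, hwH φ hφ hφc hφI] at h1
      rw [← setIntegral_eq_integral_of_forall_compl_eq_zero (s := I)]
      · simp only [Pi.sub_apply, smul_sub]
        rw [integral_sub (hG.integrableOn_smul hp hφ.continuous hφc hφI)
          (hH.integrableOn_smul hp hφ.continuous hφc hφI)]
        linarith
      · intro t ht
        rw [image_eq_zero_of_notMem_tsupport fun h => ht (interior_subset (hφI h)), zero_smul])
  rw [← volume_restrict_interior hI]
  refine (ae_restrict_iff' isOpen_interior.measurableSet).2 (h.mono fun t ht htI => ?_)
  exact sub_eq_zero.1 (ht htI)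

theorem IsWeakDerivOn.sum_mul {ι : Type*} (s : Finset ι) (a : ι → ℝ) {v G : ι → ℝ → ℝ}
    (h : ∀ i, IsWeakDerivOn I (v i) (G i)) (hp : 1 ≤ p) (hv : ∀ i, MemLpLoc (v i) p I)
    (hG : ∀ i, MemLpLoc (G i) p I) :
    IsWeakDerivOn I (fun t => ∑ i ∈ s, a i * v i t) (fun t => ∑ i ∈ s, a i * G i t) := by
  intro φ hφ hφc hφI
  simp only [Finset.smul_sum, ← smul_eq_mul (a _), smul_comm _ (a _)]
  rw [integral_finsetSum, integral_finsetSum, ← Finset.sum_neg_distrib]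
  · refine Finset.sum_congr rfl fun i _ => ?_
    rw [integral_smul, integral_smul, h i φ hφ hφc hφI, smul_neg]
  · exact fun i _ => ((hG i).integrableOn_smul hp hφ.continuous hφc hφI).smul (a i)
  · exact fun i _ => ((hv i).integrableOn_deriv_smul hp hφ hφc hφI).smul (a i)

theorem MemLpLoc.sum_mul {ι : Type*} (s : Finset ι) (a : ι → ℝ) {G : ι → ℝ → ℝ}
    (hG : ∀ i, MemLpLoc (G i) p I) : MemLpLoc (fun t => ∑ i ∈ s, a i * G i t) p I :=
  fun K hK hKc => memLp_finsetSum s fun i _ => (hG i K hK hKc).const_mul (a i)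

/-- Weak derivatives in a separable reflexive space, from scalar ones: if for each functional `ψ`
the function `ψ ∘ u` has a weak derivative bounded by `‖ψ‖ m`, with one `m ∈ L^p_loc` for
all `ψ`, then `u` has a weak derivative bounded by `m`. -/
theorem exists_weakDeriv_of_forall_dual [CompleteSpace Z] [SecondCountableTopology Z]
    (hZ : IsReflexive Z) (hI : I.OrdConnected) (hp : 1 ≤ p) {u : ℝ → Z} (hu : ContinuousOn u I)
    {m : ℝ → ℝ} (hm : MemLpLoc m p I)
    (h : ∀ ψ : StrongDual ℝ Z, ∃ G : ℝ → ℝ, MemLpLoc G p I ∧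
      (∀ t, |G t| ≤ m t * ‖ψ‖) ∧ IsWeakDerivOn I (fun t => ψ (u t)) G) :
    ∃ g : ℝ → Z, MemLpLoc g p I ∧ IsWeakDerivOn I u g := by
  borelize Z
  choose G hG hGm hGu using h
  obtain ⟨ψ, hψ⟩ := exists_separating_sequence (Z := Z)
  have hψu : ∀ i, MemLpLoc (fun t => ψ i (u t)) p I := fun i => (hu.memLpLoc p).clm_comp (ψ i)
  have hlin : ∀ᵐ t ∂(volume.restrict I), ∀ (n : ℕ) (a : Fin n → ℚ),
      |∑ i, (a i : ℝ) * G (ψ i) t| ≤ m t * ‖∑ i, (a i : ℝ) • ψ i‖ := by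
    refine ae_all_iff.2 fun n => ae_all_iff.2 fun a => ?_
    have h1 := IsWeakDerivOn.ae_eq hI hp
      (IsWeakDerivOn.sum_mul Finset.univ (fun i : Fin n => (a i : ℝ))
        (fun i => hGu (ψ i)) hp (fun i => hψu i) (fun i => hG (ψ i)))
      (hGu (∑ i, (a i : ℝ) • ψ i)) (MemLpLoc.sum_mul _ _ fun i => hG (ψ i)) (hG _)
      (fun t _ => by simp)
    filter_upwards [h1] with t ht
    rw [ht]
    exact hGm _ t
  have hval : ∀ᵐ t ∂(volume.restrict I), ∃ y : Z, ‖y‖ ≤ ‖m t‖ ∧ ∀ i, ψ i y = G (ψ i) t := by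
    filter_upwards [hlin] with t ht
    obtain ⟨Φ, hΦ, hΦψ⟩ := exists_strongDual_apply_eq ψ (fun i => G (ψ i) t) (norm_nonneg (m t))
      fun n a => (ht n a).trans
        (mul_le_mul_of_nonneg_right (le_abs_self _) (norm_nonneg _))
    obtain ⟨y, rfl⟩ := hZ Φ
    exact ⟨y, ((NormedSpace.inclusionInDoubleDualLi ℝ).norm_map y).ge.trans hΦ, hΦψ⟩
  classical
  let g : ℝ → Z := fun t =>
    if ht : ∃ y : Z, ‖y‖ ≤ ‖m t‖ ∧ ∀ i, ψ i y = G (ψ i) t then ht.choose else 0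
  have hg : ∀ᵐ t ∂(volume.restrict I), ‖g t‖ ≤ ‖m t‖ ∧ ∀ i, ψ i (g t) = G (ψ i) t := by
    filter_upwards [hval] with t ht
    simp only [g, dif_pos ht]
    exact ht.choose_spec
  -- The `ψ i` embed `Z` continuously into `ℝ^ℕ`; by the Lusin-Souslin theorem, measurability
  -- of `g` can be tested on them.
  have hemb : MeasurableEmbedding (fun (y : Z) (i : ℕ) => ψ i y) :=
    Continuous.measurableEmbedding (by fun_prop)
      fun y z hyz => hψ y z fun i => congrFun hyz i
  have hgm : AEStronglyMeasurable g (volume.restrict I) := by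
    refine AEMeasurable.aestronglyMeasurable (hemb.aemeasurable_comp_iff.1 ?_)
    refine aemeasurable_pi_iff.2 fun i => ?_
    exact (((hG (ψ i)).aestronglyMeasurable hp hI).aemeasurable).congr
      (hg.mono fun t ht => (ht.2 i).symm)
  have hgL : MemLpLoc g p I := hm.of_le hgm (hg.mono fun t ht => ht.1)
  refine ⟨g, hgL, fun φ hφ hφc hφI => hψ _ _ fun i => ?_⟩
  have h1 := (ψ i).integral_comp_comm
    ((hu.memLpLoc p).integrableOn_deriv_smul hp hφ hφc hφI)
  have h2 := (ψ i).integral_comp_comm (hgL.integrableOn_smul hp hφ.continuous hφc hφI)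
  rw [← h1, map_neg, ← h2]
  simp only [map_smul]
  rw [hGu (ψ i) φ hφ hφc hφI]
  congr 1
  refine integral_congr_ae (hg.mono fun t ht => ?_)
  simp only [ht.2 i]

/-- Membership in `W^{1,p}_loc` can be tested on functionals for continuous functions with values
in a reflexive space, separable or not, provided that the scalar weak derivatives are dominated
uniformly. -/
theorem memW1pLoc_of_forall_dual [CompleteSpace Z] (hZ : IsReflexive Z) (hI : I.OrdConnected)
    (hp : 1 ≤ p) {u : ℝ → Z} (hu : ContinuousOn u I) {m : ℝ → ℝ} (hm : MemLpLoc m p I)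
    (h : ∀ ψ : StrongDual ℝ Z, ∃ G : ℝ → ℝ, MemLpLoc G p I ∧
      (∀ t, |G t| ≤ m t * ‖ψ‖) ∧ IsWeakDerivOn I (fun t => ψ (u t)) G) :
    MemW1pLoc u p I := by
  refine ⟨hu.memLpLoc p, ?_⟩
  have hIm : MeasurableSet I := hI.measurableSet
  -- All values of `u` on `I` lie in a separable closed subspace.
  have hsep : TopologicalSpace.IsSeparable (u '' I) := hu.isSeparable_image
    (TopologicalSpace.IsSeparable.of_separableSpace I)
  set P : Submodule ℝ Z := (Submodule.span ℝ (u '' I)).topologicalClosure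
  have hPc : IsClosed (P : Set Z) := Submodule.isClosed_topologicalClosure _
  have hPs : TopologicalSpace.IsSeparable (P : Set Z) :=
    (TopologicalSpace.IsSeparable.span (R := ℝ) hsep).closure
  have : SecondCountableTopology P := hPs.secondCountableTopology
  have : CompleteSpace P := hPc.completeSpace_coe
  have huP : ∀ t ∈ I, u t ∈ P := fun t ht =>
    Submodule.le_topologicalClosure _ (Submodule.subset_span ⟨t, ht, rfl⟩)
  classical
  let v : ℝ → P := fun t => if ht : t ∈ I then ⟨u t, huP t ht⟩ else 0
  have hv : ∀ t ∈ I, (v t : Z) = u t := fun t ht => by simp only [v, dif_pos ht]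
  have hvc : ContinuousOn v I :=
    Topology.IsInducing.subtypeVal.continuousOn_iff.2 (hu.congr hv)
  obtain ⟨g, hg, hvg⟩ := exists_weakDeriv_of_forall_dual
    (hZ.submodule_of_isClosed P hPc) hI hp hvc hm (by
      intro ψ
      obtain ⟨ψ', hψ', hn⟩ := exists_extension_norm_eq P ψ
      obtain ⟨G, hG, hGm, hGu⟩ := h ψ'
      refine ⟨G, hG, fun t => hn ▸ hGm t, fun φ hφ hφc hφI => ?_⟩
      rw [← hGu φ hφ hφc hφI]
      refine setIntegral_congr_fun hIm fun t ht => ?_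
      simp only [← hψ' (v t), hv t ht])
  refine ⟨fun t => g t, hg.clm_comp P.subtypeL, fun φ hφ hφc hφI => ?_⟩
  have h1 := P.subtypeL.integral_comp_comm
    ((hvc.memLpLoc p).integrableOn_deriv_smul hp hφ hφc hφI)
  have h2 := P.subtypeL.integral_comp_comm (hg.integrableOn_smul hp hφ.continuous hφc hφI)
  have h3 : ∫ t in I, deriv φ t • u t = ∫ t in I, P.subtypeL (deriv φ t • v t) :=
    setIntegral_congr_fun hIm fun t ht => by
      simp only [map_smul, Submodule.subtypeL_apply, hv t ht]
  rw [h3, h1, hvg φ hφ hφc hφI, map_neg, ← h2]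
  simp only [map_smul, Submodule.subtypeL_apply]

end WeakDerivative

/-! ### Lifts of co-energy variables to the Dirac structure -/

section Coenergy

variable {X Q : Type*} [NormedAddCommGroup X] [NormedSpace ℝ X]
  [NormedAddCommGroup Q] [NormedSpace ℝ Q]
  (D : Submodule ℝ ((X × Q) × StrongDual ℝ (X × Q)))

theorem norm_iota_apply_le (f : X) : ‖iota D f‖ ≤ ‖f‖ :=
  ContinuousLinearMap.opNorm_le_bound _ (norm_nonneg f) fun ε => by
    rw [iota_apply, mul_comm]
    exact ((CoenergySpace.toDual D ε).le_opNorm f).trans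
      (mul_le_mul_of_nonneg_right (CoenergySpace.norm_toDual_le D ε) (norm_nonneg f))

theorem continuous_iota : Continuous (iota D) :=
  AddMonoidHomClass.continuous_of_bound (iota D) 1 fun f => by
    rw [one_mul]
    exact norm_iota_apply_le D f

/-- Each co-energy variable has a lift to `D` of norm at most twice its own; the factor `2` is there
because the infimum defining the norm of `ℰ` need not be attained. -/
theorem CoenergySpace.exists_lift (ε : CoenergySpace D) :
    ∃ (f : X) (fQ : Q) (eQ : StrongDual ℝ Q),
      ((f, fQ), (CoenergySpace.toDual D ε).coprod eQ) ∈ D ∧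
      ‖f‖ ≤ 2 * ‖ε‖ ∧ ‖fQ‖ ≤ 2 * ‖ε‖ ∧ ‖eQ‖ ≤ 2 * ‖ε‖ := by
  rcases eq_or_ne ε 0 with rfl | hε
  -- The strict inequality `‖ε‖ < 2 * ‖ε‖` fails for `ε = 0`, which has the zero lift.
  · refine ⟨0, 0, 0, ?_, by simp, by simp, by simp⟩
    convert D.zero_mem using 1
    ext <;> simp
  · have hpos : 0 < ‖ε‖ := norm_pos_iff.2 hε
    have hlt : sInf (liftNorms D (CoenergySpace.toDual D ε)) < 2 * ‖ε‖ := by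
      rw [← CoenergySpace.norm_def]
      linarith
    obtain ⟨_, ⟨f, fQ, eQ, hD, rfl⟩, hr⟩ := exists_lt_of_csInf_lt (liftNorms_nonempty D ε) hlt
    refine ⟨f, fQ, eQ, hD, ?_, ?_, ?_⟩ <;> refine le_trans ?_ hr.le
    · exact (norm_fst_le (f, fQ)).trans (norm_fst_le ((f, fQ), (CoenergySpace.toDual D ε, eQ)))
    · exact (norm_snd_le (f, fQ)).trans (norm_fst_le ((f, fQ), (CoenergySpace.toDual D ε, eQ)))
    · exact (norm_snd_le (CoenergySpace.toDual D ε, eQ)).trans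
        (norm_snd_le ((f, fQ), (CoenergySpace.toDual D ε, eQ)))

theorem isTestC1_smul_const {Z : Type*} [NormedAddCommGroup Z] [NormedSpace ℝ Z] {I : Set ℝ}
    {φ : ℝ → ℝ} (hφ : ContDiff ℝ ∞ φ) (hφc : HasCompactSupport φ)
    (hφI : tsupport φ ⊆ interior I) (z : Z) : IsTestC1 I (fun t => φ t • z) :=
  ⟨(hφ.of_le (by simp)).smul contDiff_const, hφc.smul_right,
    (tsupport_smul_subset_left φ fun _ => z).trans hφI⟩

end Coenergy

end PortHamiltonian


open PortHamiltonian in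
theorem theorem3p2
    {X Q : Type*} [NormedAddCommGroup X] [NormedSpace ℝ X] [CompleteSpace X]
    [NormedAddCommGroup Q] [NormedSpace ℝ Q] [CompleteSpace Q]
    (D : Submodule ℝ ((X × Q) × StrongDual ℝ (X × Q))) (hD : IsDiracStructure D)
    (hrefl : IsReflexive (CoenergySpace D))
    (I : Set ℝ) (hI : I.OrdConnected) (p : ℝ≥0∞) (hp : 1 ≤ p) (hp' : p ≠ ⊤)
    (x : ℝ → X) (e : ℝ → StrongDual ℝ X) (fQ : ℝ → Q) (eQ : ℝ → StrongDual ℝ Q)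
    (hx : ContinuousOn x I) (he : MemLpLoc e p I) (hfQ : MemLpLoc fQ p I)
    (heQ : MemLpLoc eQ p I)
    (hweak : ∀ (χ : ℝ → X) (ρ : ℝ → StrongDual ℝ X) (χQ : ℝ → Q) (ρQ : ℝ → StrongDual ℝ Q),
      IsTestC1 I χ → IsTestC1 I ρ → IsTestC1 I χQ → IsTestC1 I ρQ →
      (∀ t ∈ I, ((χ t, χQ t), (ρ t).coprod (ρQ t)) ∈ D) →
      ∫ t in I, bondForm ((x t, fQ t), (e t).coprod (eQ t))
        ((χ t, χQ t), (deriv ρ t).coprod (ρQ t)) = 0) :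
    MemW1pLoc (fun t => iota D (x t)) p I := by
  refine memW1pLoc_of_forall_dual hrefl.strongDual hI hp ((continuous_iota D).comp_continuousOn hx)
    (((he.norm.add heQ.norm).add hfQ.norm).const_mul 2) fun ψ => ?_
  -- By reflexivity, a functional on `ℰ'` is evaluation at a co-energy variable `ε`.
  obtain ⟨ε, rfl⟩ := hrefl ψ
  have hε : ‖NormedSpace.inclusionInDoubleDual ℝ (CoenergySpace D) ε‖ = ‖ε‖ :=
    (NormedSpace.inclusionInDoubleDualLi ℝ).norm_map ε
  simp only [hε, NormedSpace.dual_def]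
  obtain ⟨f, fQ', eQ', hmem, hf, hfQ', heQ'⟩ := CoenergySpace.exists_lift D ε
  have hG : MemLpLoc (fun t => e t f + eQ t fQ' + eQ' (fQ t)) p I :=
    ((he.clm_comp (ContinuousLinearMap.apply ℝ ℝ f)).add
      (heQ.clm_comp (ContinuousLinearMap.apply ℝ ℝ fQ'))).add (hfQ.clm_comp eQ')
  refine ⟨fun t => e t f + eQ t fQ' + eQ' (fQ t), hG, fun t => ?_, fun φ hφ hφc hφI => ?_⟩
  · have h1 := (e t).le_opNorm f
    have h2 := (eQ t).le_opNorm fQ'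
    have h3 := eQ'.le_opNorm (fQ t)
    have h4 : |e t f + eQ t fQ' + eQ' (fQ t)| ≤ ‖e t f‖ + ‖eQ t fQ'‖ + ‖eQ' (fQ t)‖ :=
      abs_add_three _ _ _
    have h5 := mul_le_mul_of_nonneg_left hf (norm_nonneg (e t))
    have h6 := mul_le_mul_of_nonneg_left hfQ' (norm_nonneg (eQ t))
    have h7 := mul_le_mul_of_nonneg_right heQ' (norm_nonneg (fQ t))
    linarith
  · -- Test with `φ` times the chosen lift of `ε`.
    have h := hweak (fun t => φ t • f) (fun t => φ t • CoenergySpace.toDual D ε)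
      (fun t => φ t • fQ') (fun t => φ t • eQ') (isTestC1_smul_const hφ hφc hφI _)
      (isTestC1_smul_const hφ hφc hφI _) (isTestC1_smul_const hφ hφc hφI _)
      (isTestC1_smul_const hφ hφc hφI _) (fun t _ => by
        convert D.smul_mem (φ t) hmem using 1
        ext <;> simp)
    have hd : ∀ t, deriv (fun t => φ t • CoenergySpace.toDual D ε) t =
        deriv φ t • CoenergySpace.toDual D ε := fun t =>
      (((hφ.differentiable (by simp)) t).hasDerivAt.smul_const
        (CoenergySpace.toDual D ε)).deriv
    have hbond : ∀ t, bondForm ((x t, fQ t), (e t).coprod (eQ t))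
        ((φ t • f, φ t • fQ'),
          (deriv (fun t => φ t • CoenergySpace.toDual D ε) t).coprod (φ t • eQ')) =
        deriv φ t • iota D (x t) ε + φ t • (e t f + eQ t fQ' + eQ' (fQ t)) := by
      intro t
      rw [hd, iota_apply]
      simp only [bondForm, ContinuousLinearMap.coprod_apply, smul_apply,
        map_smul, smul_eq_mul]
      ring
    have hu : MemLpLoc (fun t => iota D (x t) ε) p I :=
      ((((continuous_iota D).comp_continuousOn hx).memLpLoc p).clm_comp
        (ContinuousLinearMap.apply ℝ ℝ ε))
    simp only [hbond] at h
    rw [integral_add (hu.integrableOn_deriv_smul hp hφ hφc hφI)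
      (hG.integrableOn_smul hp hφ.continuous hφc hφI)] at h
    exact eq_neg_of_add_eq_zero_left h
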